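/- Let $d,L\ge 1$. A *shape* is a weakly decreasing sequence of integers $\lambda=(\lambda_i)_{i\in\mathbb Z}$ with $\lambda_i=\lambda_{i+d}+L$ for all $i$. A *cell* $\langle i,j\rangle$ is a class of $\mathbb Z^2/\mathbb Z(-d,L)$ (row $i$, column $j$; rows are thus indexed modulo $d$), and $Y_\lambda=\{\langle i,j\rangle: j\le\lambda_i\}$. Write $\mu\subseteq\lambda$ if $Y_\mu\subseteq Y_\lambda$; then put $Y_{\lambda/\mu}=Y_\lambda\setminus Y_\mu$ and $|\lambda/\mu|=|Y_{\lambda/\mu}|$. Let $\mathrm{SCT}(\lambda/\mu)$ be the set of standard cylindric tableaux of shape $\lambda/\mu$, i.e. of bijections $Y_{\lambda/\mu}\to\{1,\dots,|\lambda/\mu|\}$ that increase along rows (left to right) and down columns. The *walk representation* of $T\in\mathrm{SCT}(\lambda/\mu)$ with $n=|\lambda/\mu|$ is the sequence of shapes $\lambda^{(0)},\dots,\lambda^{(n)}$, where $Y_{\lambda^{(k)}}$ consists of $Y_\mu$ and the cells of $T$ with entries $1,\dots,k$. *Growth diagrams.* Let $T\in\mathrm{SCT}(\alpha/\mu)$ and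 $U\in\mathrm{SCT}(\beta/\mu)$, $n=|\alpha/\mu|$, $m=|\beta/\mu|$. Label the vertices $(x,y)$, $0\le x\le m$, $0\le y\le n$, of a grid by shapes $\rho^{(x,y)}$ so that $\rho^{(0,0)},\dots,\rho^{(0,n)}$ is the walk representation of $T$, $\rho^{(0,0)},\dots,\rho^{(m,0)}$ is that of $U$, and in each unit square the labels $\rho^{ll},\rho^{ul},\rho^{lr},\rho^{ur}$ of the lower left, upper left, lower right and upper right vertices satisfy: (F1) if $\rho^{ul}\ne\rho^{lr}$, then $\rho^{ur}_i=\max\{\rho^{ul}_i,\rho^{lr}_i\}$ for all $i$; (F2) if $\rho^{ul}=\rho^{lr}$ is obtained from $\rho^{ll}$ by adding a cell in row $i$, then $\rho^{ur}$ is obtained from $\rho^{ul}$ by adding a cell in row $i+1$. Let $\lambda=\rho^{(m,n)}$, and let $\tilde P\in\mathrm{SCT}(\lambda/\beta)$ and $\tilde Q\in\mathrm{SCT}(\lambda/\alpha)$ be the tableaux whose walk representations are the right boundary $\rho^{(m,0)},\dots,\rho^{(m,n)}$ and the top boundary $\rho^{(0,n)},\dots,\rho^{(m,n)}$. *Insertion.*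 Let $P$ be a standard cylindric tableau of shape $\lambda/\mu$ and let $\mu_{i-1}>\mu_i$. *Internal insertion in $P$ at row $i$* is the following. If $\mu_i=\lambda_i$, add $1$ to both $\mu_i$ and $\lambda_i$; the procedure terminates at the cell $\langle i,\lambda_i+1\rangle$ (with the old value of $\lambda_i$). Otherwise remove the cell $\langle i,\mu_i+1\rangle$, with entry $a$, from the tableau (adding $1$ to $\mu_i$), and insert $a$ into row $i+1$. To insert $a$ into row $r$: if $a$ is larger than all the entries of row $r$, put $a$ in a new cell at the end of row $r$ (adding $1$ to $\lambda_r$) and terminate there; otherwise $a$ replaces the smallest entry $a'>a$ of row $r$, and $a'$ is inserted into row $r+1$. The *cylindric Robinson–Schensted map* sends $(T,U)$ to $\mathrm{CRS}(T,U)=(P_m,Q_m)$, where $P_0=T$, $Q_0$ is the empty tableau of shape $\alpha/\alpha$, and for $k=1,\dots,m$, $P_k$ is obtained from $P_{k-1}$ by internal insertion at row $i$, where $\langle i,j\rangle$ is the cell of $U$ with entry $k$ (which is $\langle i,\nu_i+1\rangle$ for the inner shape $\nu$ of $P_{k-1}$), and $Q_k$ is obtained from $Q_{k-1}$ by placing $k$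 in the cell where this insertion terminates. **Theorem.** For all shapes $\mu\subseteq\alpha,\beta$ and all $(T,U)\in\mathrm{SCT}(\alpha/\mu)\times\mathrm{SCT}(\beta/\mu)$ both constructions are well defined: the growth diagram of $(T,U)$ exists and is unique, and so do and are the pair $(\tilde P,\tilde Q)$ and the pair $(P,Q)=\mathrm{CRS}(T,U)$. Moreover $(P,Q)\in\mathrm{SCT}(\lambda/\beta)\times\mathrm{SCT}(\lambda/\alpha)$ for some $\lambda\supseteq\alpha,\beta$ with $|\lambda/\beta|=n$ and $|\lambda/\alpha|=m$, where $n=|\alpha/\mu|$ and $m=|\beta/\mu|$, and $$(\tilde P,\tilde Q)=(P,Q).$$ -/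

import Mathlib

/-- A cylindric shape of period `(d, L)`: a doubly infinite weakly decreasing integer sequence
with `row i = row (i + d) + L`. -/
@[ext]
structure CylShape (d L : ℕ) where
  row : ℤ → ℤ
  anti : Antitone row
  period : ∀ i : ℤ, row i = row (i + (d : ℤ)) + (L : ℤ)

/-- The cylinder `ℤ² / (-d, L)ℤ`; its elements are the cells. -/
abbrev Cell (d L : ℕ) : Type :=
  (ℤ × ℤ) ⧸ AddSubgroup.zmultiples ((-(d : ℤ), (L : ℤ)) : ℤ × ℤ)

/-- The cell `⟨i, j⟩`, in row `i` and column `j`. -/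
def cell {d L : ℕ} (i j : ℤ) : Cell d L :=
  QuotientAddGroup.mk ((i, j) : ℤ × ℤ)

namespace CylShape

variable {d L : ℕ}

/-- The Young diagram of a shape. -/
def diagram (lam : CylShape d L) : Set (Cell d L) :=
  {c | ∃ i j : ℤ, c = cell i j ∧ j ≤ lam.row i}

/-- Containment of shapes is containment of Young diagrams. -/
instance : HasSubset (CylShape d L) := ⟨fun mu lam => mu.diagram ⊆ lam.diagram⟩

/-- The Young diagram of the skew shape `lam / mu`. -/
def skewDiagram (lam mu : CylShape d L) : Set (Cell d L) :=
  lam.diagram \ mu.diagram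

/-- The number of cells of `lam / mu`. -/
noncomputable def skewCard (lam mu : CylShape d L) : ℕ :=
  (skewDiagram lam mu).ncard

/-- `nu` is obtained from `mu` by adding one cell, in row `i` (rows are indexed modulo `d`). -/
def AddsCell (mu : CylShape d L) (i : ℤ) (nu : CylShape d L) : Prop :=
  ∀ j : ℤ, nu.row j = if j ≡ i [ZMOD (d : ℤ)] then mu.row j + 1 else mu.row j

/-- Row `i` is an insertion corner of `mu`. -/
def IsInsertionCorner (mu : CylShape d L) (i : ℤ) : Prop :=
  mu.row i < mu.row (i - 1)

end CylShape

/-- An outer shape, an inner shape and a placement of positive integers in some of the cells of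
the cylinder; the value `0` means that the cell has no entry. These are the states that occur
during an insertion; standard cylindric tableaux are singled out by `SCT`. -/
@[ext]
structure Filling (d L : ℕ) where
  outer : CylShape d L
  inner : CylShape d L
  entry : Cell d L → ℕ

section

variable {d L : ℕ}

/-- The standard cylindric tableaux of shape `lam / mu`: the cells of `lam / mu`, and no others,
are filled bijectively with `1, …, |lam / mu|`, increasingly along rows and down columns. -/
def SCT (lam mu : CylShape d L) : Set (Filling d L) :=
  {T | T.outer = lam ∧ T.inner = mu ∧ mu ⊆ lam ∧
    Set.BijOn T.entry (lam.skewDiagram mu) (Set.Icc 1 (lam.skewCard mu)) ∧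
    (∀ c, c ∉ lam.skewDiagram mu → T.entry c = 0) ∧
    (∀ i j : ℤ, cell i j ∈ lam.skewDiagram mu → cell (i + 1) j ∈ lam.skewDiagram mu →
      T.entry (cell i j) < T.entry (cell (i + 1) j)) ∧
    (∀ i j : ℤ, cell i j ∈ lam.skewDiagram mu → cell i (j + 1) ∈ lam.skewDiagram mu →
      T.entry (cell i j) < T.entry (cell i (j + 1)))}

/-- `w 0, …, w n` is the walk representation of the tableau `T` with `n` cells: the diagram of
`w k` consists of the inner shape together with the cells of `T` with entries `1, …, k`. -/
def IsWalkRep (T : Filling d L) (n : ℕ) (w : Fin (n + 1) → CylShape d L) : Prop :=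
  T.outer.skewCard T.inner = n ∧
  ∀ k : Fin (n + 1),
    (w k).diagram = T.inner.diagram ∪ {c | 1 ≤ T.entry c ∧ T.entry c ≤ (k : ℕ)}

/-! ### Growth diagrams -/

/-- The forward local rule for the labels of a unit square: lower left, upper left, lower right,
upper right. -/
def ForwardRule (ll ul lr ur : CylShape d L) : Prop :=
  (ul ≠ lr → ∀ i : ℤ, ur.row i = max (ul.row i) (lr.row i)) ∧
  (ul = lr → ∃ i : ℤ, ll.AddsCell i ul ∧ ul.AddsCell (i + 1) ur)

/-- `rho x y` is the label of the vertex `(x, y)`, for `0 ≤ x ≤ m` and `0 ≤ y ≤ n`, in the growth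
diagram whose left and bottom boundaries are given by `T` and `U`. -/
def IsGrowthDiagram (m n : ℕ) (T U : Filling d L)
    (rho : Fin (m + 1) → Fin (n + 1) → CylShape d L) : Prop :=
  IsWalkRep T n (fun y => rho 0 y) ∧
  IsWalkRep U m (fun x => rho x 0) ∧
  ∀ (x : Fin m) (y : Fin n),
    ForwardRule (rho x.castSucc y.castSucc) (rho x.castSucc y.succ)
      (rho x.succ y.castSucc) (rho x.succ y.succ)

/-- `PQ` is the pair of standard cylindric tableaux whose walk representations are the right and
the top boundary of the growth diagram of `(T, U)`. -/
def IsGrowthImage (m n : ℕ) (T U : Filling d L) (PQ : Filling d L × Filling d L) : Prop :=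
  ∃ rho : Fin (m + 1) → Fin (n + 1) → CylShape d L,
    IsGrowthDiagram m n T U rho ∧
    PQ.1 ∈ SCT (rho (Fin.last m) (Fin.last n)) (rho (Fin.last m) 0) ∧
    IsWalkRep PQ.1 n (fun y => rho (Fin.last m) y) ∧
    PQ.2 ∈ SCT (rho (Fin.last m) (Fin.last n)) (rho 0 (Fin.last n)) ∧
    IsWalkRep PQ.2 m (fun x => rho x (Fin.last n))

/-! ### Internal row insertion -/

open Classical in
/-- Put the entry `a` in the cell `c`, replacing what was there (`a = 0` empties the cell). -/
noncomputable def Filling.setEntry (F : Filling d L) (c : Cell d L) (a : ℕ) : Filling d L :=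
  { F with entry := Function.update F.entry c a }

/-- `RowInsert F r a G c`: inserting `a` into row `r` of `F`, and then recursively the replaced
entries into the following rows, ends with `G`, and `c` is the cell added at the end. -/
inductive RowInsert : Filling d L → ℤ → ℕ → Filling d L → Cell d L → Prop
  | place (F : Filling d L) (r : ℤ) (a : ℕ) (nu : CylShape d L)
      (largest : ∀ j : ℤ, F.entry (cell r j) < a)
      (hnu : F.outer.AddsCell r nu) :
      RowInsert F r a
        { F.setEntry (cell r (F.outer.row r + 1)) a with outer := nu }
        (cell r (F.outer.row r + 1))
  | bump (F : Filling d L) (r : ℤ) (a : ℕ) (j : ℤ) (G : Filling d L) (c : Cell d L)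
      (larger : a < F.entry (cell r j))
      (smallest : ∀ j' : ℤ, a < F.entry (cell r j') → F.entry (cell r j) ≤ F.entry (cell r j'))
      (next : RowInsert (F.setEntry (cell r j) a) (r + 1) (F.entry (cell r j)) G c) :
      RowInsert F r a G c

/-- `IsInsertion i T T' c`: internal insertion in `T` at row `i` gives `T'`, and `c` is the cell
where the procedure terminates, that is, the cell added to the outer shape. -/
def IsInsertion (i : ℤ) (T T' : Filling d L) (c : Cell d L) : Prop :=
  T.inner.IsInsertionCorner i ∧
  ∃ nu : CylShape d L, T.inner.AddsCell i nu ∧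
    ((T.inner.row i < T.outer.row i ∧
        RowInsert { T.setEntry (cell i (T.inner.row i + 1)) 0 with inner := nu } (i + 1)
          (T.entry (cell i (T.inner.row i + 1))) T' c) ∨
      (T.inner.row i = T.outer.row i ∧
        ∃ nu' : CylShape d L, T.outer.AddsCell i nu' ∧
          T' = { T with outer := nu', inner := nu } ∧
          c = cell i (T.outer.row i + 1)))

/-- `F'` is obtained from `F` by adding the cell `c` to the outer shape, with entry `k`. -/
def PlacesAt (F : Filling d L) (c : Cell d L) (k : ℕ) (F' : Filling d L) : Prop :=
  c ∉ F.outer.diagram ∧ F'.outer.diagram = insert c F.outer.diagram ∧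
  F'.inner = F.inner ∧ F'.entry = (F.setEntry c k).entry

/-- `PQ` is the image of `(T, U)`, where `U` has `m` cells, under the cylindric
Robinson–Schensted map: starting from `(T, ∅)`, for `k = 1, …, m`, insert internally at the cell
of `U` that contains `k`, and record `k` in the cell where the insertion terminates. -/
def IsCRS (m : ℕ) (T U : Filling d L) (PQ : Filling d L × Filling d L) : Prop :=
  ∃ P Q : Fin (m + 1) → Filling d L,
    P 0 = T ∧ Q 0 = ⟨T.outer, T.outer, fun _ => 0⟩ ∧
    (∀ k : Fin m, ∃ (i j : ℤ) (c : Cell d L),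
      U.entry (cell i j) = (k : ℕ) + 1 ∧
      j = (P k.castSucc).inner.row i + 1 ∧
      IsInsertion i (P k.castSucc) (P k.succ) c ∧
      PlacesAt (Q k.castSucc) c ((k : ℕ) + 1) (Q k.succ)) ∧
    PQ = (P (Fin.last m), Q (Fin.last m))

end

/-! ### Cells of the cylinder, shapes, and adding a cell to a shape. -/

section Shapes

variable {d L : ℕ}

/-! A standard cylindric tableau amounts to a walk of shapes adding one cell at a time
(`exists_walk_of_mem_SCT`, `IsWalk.eq_walkTableau`), so the two constructions can be compared column
by column in the growth diagram. The heart of the matter is that passing from one column to the next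
is one internal insertion (`IsColumnPair.isInsertion`).

Let `w` and `v` be adjacent columns. At each height `k`, `v k` has one cell more than `w k`, in some
row `r`. If step `k + 1` of `w` is in another row, `v` adds the same cell and the entry `k + 1`
stays put. If it is in row `r`, that cell is already occupied in `v k`, and (F2) sends `k + 1` to
row `r + 1`: it has been bumped. So `r` follows the bumping path as `k` grows, the hybrid fillings
`mixedEntry` are the intermediate states, and `IsColumnPair.rowInsert` makes this precise by
descending induction on `k`.

The forward rule always applies (`exists_forwardRule`) and is deterministic, and so is insertion
(`IsInsertion.unique`). Both constructions therefore have exactly one outcome, read off the right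
and top boundaries of `growthGrid`. The top boundary records the insertions because each one
terminates at the cell separating two consecutive top labels. -/

theorem cell_eq_cell_iff {i j i' j' : ℤ} :
    (cell i j : Cell d L) = cell i' j' ↔ ∃ t : ℤ, i' = i - t * d ∧ j' = j + t * L := by
  unfold cell
  rw [QuotientAddGroup.eq, AddSubgroup.mem_zmultiples_iff]
  refine exists_congr fun t => ?_
  simp only [Prod.ext_iff, Prod.smul_mk, Prod.mk_add_mk, Prod.neg_mk, smul_eq_mul]
  constructor <;> rintro ⟨h₁, h₂⟩ <;> constructor <;> linarith

theorem exists_eq_cell (c : Cell d L) : ∃ i j : ℤ, c = cell i j := by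
  induction c using QuotientAddGroup.induction_on with
  | H z => exact ⟨z.1, z.2, rfl⟩

theorem modEq_of_cell_eq {i j i' j' : ℤ} (h : (cell i j : Cell d L) = cell i' j') :
    i ≡ i' [ZMOD d] := by
  obtain ⟨t, rfl, -⟩ := cell_eq_cell_iff.1 h
  exact (Int.modEq_iff_dvd).2 ⟨-t, by ring⟩

/-- Cells of congruent rows are the same cells, up to a shift of the columns. -/
theorem exists_shift_of_modEq {i i' : ℤ} (h : i ≡ i' [ZMOD d]) :
    ∃ s : ℤ, ∀ j, (cell i' (j + s) : Cell d L) = cell i j := by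
  obtain ⟨t, ht⟩ := Int.modEq_iff_dvd.1 h
  exact ⟨-t * L, fun j => (cell_eq_cell_iff.2 ⟨-t, by linarith, rfl⟩).symm⟩

theorem cell_row_eq_cell_row_iff (hd : 0 < d) {i j j' : ℤ} :
    (cell i j : Cell d L) = cell i j' ↔ j = j' := by
  refine ⟨fun h => ?_, fun h => h ▸ rfl⟩
  obtain ⟨t, h₁, h₂⟩ := cell_eq_cell_iff.1 h
  have : t * (d : ℤ) = 0 := by linarith
  have : t = 0 := by
    rcases mul_eq_zero.1 this with h | h
    · exact h
    · omega
  simp [h₂, this]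

namespace CylShape

theorem row_sub_mul (lam : CylShape d L) (i t : ℤ) :
    lam.row (i - t * d) = lam.row i + t * L := by
  induction t using Int.induction_on with
  | zero => simp
  | succ t ih =>
    rw [lam.period, show i - ((t : ℤ) + 1) * d + d = i - t * d by ring, ih]
    ring
  | pred t ih =>
    have h := lam.period (i - (-(t : ℤ)) * d)
    rw [ih, show i - (-(t : ℤ)) * d + d = i - (-(t : ℤ) - 1) * d by ring] at h
    linarith

theorem cell_row_congr (lam : CylShape d L) {i i' : ℤ} (h : i ≡ i' [ZMOD d]) (b : ℤ) :
    (cell i (lam.row i + b) : Cell d L) = cell i' (lam.row i' + b) := by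
  obtain ⟨t, ht⟩ := Int.modEq_iff_dvd.1 h
  obtain rfl : i' = i - (-t) * d := by linarith
  rw [row_sub_mul]
  exact cell_eq_cell_iff.2 ⟨-t, rfl, by ring⟩

theorem cell_mem_diagram {lam : CylShape d L} {i j : ℤ} :
    cell i j ∈ lam.diagram ↔ j ≤ lam.row i := by
  refine ⟨?_, fun h => ⟨i, j, rfl, h⟩⟩
  rintro ⟨i', j', h, hj⟩
  obtain ⟨t, rfl, rfl⟩ := cell_eq_cell_iff.1 h
  rw [row_sub_mul] at hj
  linarith

theorem diagram_subset_iff {mu lam : CylShape d L} :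
    mu.diagram ⊆ lam.diagram ↔ ∀ i, mu.row i ≤ lam.row i := by
  constructor
  · intro h i
    exact cell_mem_diagram.1 (h (cell_mem_diagram.2 le_rfl))
  · rintro h c ⟨i, j, rfl, hj⟩
    exact cell_mem_diagram.2 (hj.trans (h i))

theorem diagram_injective : Function.Injective (diagram : CylShape d L → Set (Cell d L)) := by
  intro mu lam h
  ext i
  exact le_antisymm (diagram_subset_iff.1 h.subset i) (diagram_subset_iff.1 h.superset i)

namespace AddsCell

variable {mu nu nu' : CylShape d L} {i i' : ℤ}

theorem congr (h : mu.AddsCell i nu) (hi : i ≡ i' [ZMOD d]) : mu.AddsCell i' nu := by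
  intro j
  rw [h j]
  have : j ≡ i [ZMOD d] ↔ j ≡ i' [ZMOD d] := ⟨fun h => h.trans hi, fun h => h.trans hi.symm⟩
  simp [this]

theorem row_self (h : mu.AddsCell i nu) : nu.row i = mu.row i + 1 := by
  simp [h i, Int.ModEq.refl]

theorem row_of_not_modEq (h : mu.AddsCell i nu) {j : ℤ} (hj : ¬ j ≡ i [ZMOD d]) :
    nu.row j = mu.row j := by
  simp [h j, hj]

theorem row_of_modEq (h : mu.AddsCell i nu) {j : ℤ} (hj : j ≡ i [ZMOD d]) :
    nu.row j = mu.row j + 1 := by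
  simp [h j, hj]

theorem row_le (h : mu.AddsCell i nu) (j : ℤ) : mu.row j ≤ nu.row j := by
  rw [h j]; split_ifs <;> omega

theorem unique (h : mu.AddsCell i nu) (h' : mu.AddsCell i nu') : nu = nu' := by
  ext j
  rw [h j, h' j]

theorem modEq (h : mu.AddsCell i nu) (h' : mu.AddsCell i' nu) : i ≡ i' [ZMOD d] := by
  by_contra hi
  have h₁ := h.row_self
  have h₂ := h'.row_of_not_modEq hi
  omega

theorem notMem (_ : mu.AddsCell i nu) : cell i (mu.row i + 1) ∉ mu.diagram := by
  rw [cell_mem_diagram]; omega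

theorem diagram_eq (h : mu.AddsCell i nu) :
    nu.diagram = insert (cell i (mu.row i + 1)) mu.diagram := by
  ext c
  obtain ⟨p, q, rfl⟩ := exists_eq_cell c
  rw [Set.mem_insert_iff, cell_mem_diagram, cell_mem_diagram]
  constructor
  · intro hq
    by_cases hp : p ≡ i [ZMOD d]
    · rw [h.row_of_modEq hp] at hq
      rcases hq.lt_or_eq with hq | rfl
      · exact .inr (by omega)
      · exact .inl (mu.cell_row_congr hp 1)
    · exact .inr (h.row_of_not_modEq hp ▸ hq)
  · rintro (hc | hq)
    · rw [← cell_mem_diagram, hc, cell_mem_diagram, h.row_self]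
    · exact hq.trans (h.row_le p)

theorem mem (h : mu.AddsCell i nu) : cell i (mu.row i + 1) ∈ nu.diagram :=
  h.diagram_eq ▸ Set.mem_insert _ _

theorem subset (h : mu.AddsCell i nu) : mu.diagram ⊆ nu.diagram :=
  h.diagram_eq ▸ Set.subset_insert _ _

theorem eq_of_mem (h : mu.AddsCell i nu) {c : Cell d L} (hc : c ∈ nu.diagram)
    (hc' : c ∉ mu.diagram) : c = cell i (mu.row i + 1) := by
  rw [h.diagram_eq] at hc
  exact hc.resolve_right hc'

theorem isInsertionCorner (hd : 0 < d) (hL : 0 < L) (h : mu.AddsCell i nu) :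
    mu.IsInsertionCorner i := by
  unfold IsInsertionCorner
  have h₁ := h.row_self
  have h₂ : nu.row i ≤ nu.row (i - 1) := nu.anti (by omega)
  -- Congruent neighbouring rows force `d = 1`; the strict descent then comes from the period `L >
  -- 0`, not from `nu`.
  by_cases hi : i - 1 ≡ i [ZMOD d]
  · obtain ⟨t, ht⟩ := Int.modEq_iff_dvd.1 hi
    have hd1 : (d : ℤ) = 1 := by
      have : (d : ℤ) ∣ 1 := ⟨t, by linarith⟩
      exact Int.eq_one_of_dvd_one (by positivity) this
    have h₃ := mu.period (i - 1)
    rw [hd1, sub_add_cancel] at h₃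
    omega
  · have := h.row_of_not_modEq hi
    omega

end AddsCell

/-- Periodicity carries the corner inequality to every row congruent to `i`, so lengthening all of
them by one keeps the sequence decreasing. -/
theorem IsInsertionCorner.exists_addsCell {mu : CylShape d L} {i : ℤ}
    (h : mu.IsInsertionCorner i) : ∃ nu, mu.AddsCell i nu := by
  have hrow : ∀ j : ℤ, j ≡ i [ZMOD d] → mu.row j < mu.row (j - 1) := by
    intro j hj
    obtain ⟨t, ht⟩ := Int.modEq_iff_dvd.1 hj
    have h₁ := mu.row_sub_mul i t
    have h₂ := mu.row_sub_mul (i - 1) t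
    rw [show i - t * d = j by linarith] at h₁
    rw [show i - 1 - t * d = j - 1 by linarith] at h₂
    unfold IsInsertionCorner at h
    omega
  refine ⟨⟨fun j => if j ≡ i [ZMOD d] then mu.row j + 1 else mu.row j, ?_, ?_⟩, fun j => rfl⟩
  · refine antitone_int_of_succ_le fun j => ?_
    have h₁ : mu.row (j + 1) ≤ mu.row j := mu.anti (by omega)
    have h₂ := hrow (j + 1)
    rw [add_sub_cancel_right] at h₂
    split_ifs with h₃ h₄ h₄
    · omega
    · exact h₂ h₃
    · omega
    · omega
  · intro j
    have : j + d ≡ i [ZMOD d] ↔ j ≡ i [ZMOD d] := by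
      simp [Int.ModEq]
    have := mu.period j
    simp only [*]
    split_ifs <;> omega

end CylShape

end Shapes

/-! ### Local rules -/

section LocalRules

variable {d L : ℕ} {ll ul lr ur ur' : CylShape d L}

theorem ForwardRule.unique (h : ForwardRule ll ul lr ur) (h' : ForwardRule ll ul lr ur') :
    ur = ur' := by
  by_cases hne : ul = lr
  · obtain ⟨i, hi, hi'⟩ := h.2 hne
    obtain ⟨k, hk, hk'⟩ := h'.2 hne
    exact (hi'.congr ((hi.modEq hk).add_right 1)).unique hk'
  · ext i
    rw [h.1 hne, h'.1 hne]

/-- If the two added cells are in different rows, both are added at the upper right vertex. -/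
theorem ForwardRule.addsCell_of_not_modEq {r s : ℤ} (h : ForwardRule ll ul lr ur)
    (hs : ll.AddsCell s ul) (hr : ll.AddsCell r lr) (hrs : ¬ r ≡ s [ZMOD d]) :
    lr.AddsCell s ur ∧ ul.AddsCell r ur := by
  have hne : ul ≠ lr := by
    rintro rfl
    exact hrs (hr.modEq hs)
  have hmax := h.1 hne
  constructor
  all_goals
    intro j
    rw [hmax j, hs j, hr j]
    have : j ≡ r [ZMOD d] → ¬ j ≡ s [ZMOD d] := fun h h' => hrs (h.symm.trans h')
    split_ifs <;> simp_all

/-- If both added cells are in row `r`, the cell added next is in row `r + 1`. -/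
theorem ForwardRule.addsCell_of_modEq {r s : ℤ} (h : ForwardRule ll ul lr ur)
    (hs : ll.AddsCell s ul) (hr : ll.AddsCell r lr) (hrs : r ≡ s [ZMOD d]) :
    ul = lr ∧ lr.AddsCell (r + 1) ur := by
  have heq : ul = lr := hs.unique (hr.congr hrs)
  obtain ⟨i, hi, hi'⟩ := h.2 heq
  refine ⟨heq, ?_⟩
  subst heq
  exact hi'.congr ((hi.modEq hr).add_right 1)

/-- What has to be checked is that the row prescribed by the rule is a corner. For a common row `s`,
lengthening it makes row `s + 1` a corner; for different rows, the corner `s` of `ll` survives in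
`lr`. -/
theorem exists_forwardRule (hd : 0 < d) (hL : 0 < L) {r s : ℤ} (hs : ll.AddsCell s ul)
    (hr : ll.AddsCell r lr) : ∃ ur, ForwardRule ll ul lr ur := by
  by_cases hrs : r ≡ s [ZMOD d]
  · have heq : ul = lr := hs.unique (hr.congr hrs)
    subst heq
    have hcorner : ul.IsInsertionCorner (s + 1) := by
      unfold CylShape.IsInsertionCorner
      rw [add_sub_cancel_right, hs.row_self]
      -- Here `d = 1`, so row `s + 1` has grown as well, and `L > 0` supplies the strict inequality.
      by_cases h1 : s + 1 ≡ s [ZMOD d]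
      · obtain ⟨t, ht⟩ := Int.modEq_iff_dvd.1 h1
        have hd1 : (d : ℤ) = 1 :=
          Int.eq_one_of_dvd_one (by positivity) ⟨-t, by linarith⟩
        have := ll.period s
        rw [hd1] at this
        rw [hs.row_of_modEq h1]
        omega
      · rw [hs.row_of_not_modEq h1]
        have : ll.row (s + 1) ≤ ll.row s := ll.anti (by omega)
        omega
    obtain ⟨ur, hur⟩ := hcorner.exists_addsCell
    exact ⟨ur, fun h => absurd rfl h, fun _ => ⟨s, hs, hur⟩⟩
  · have hcorner : lr.IsInsertionCorner s := by
      unfold CylShape.IsInsertionCorner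
      rw [hr.row_of_not_modEq fun h => hrs h.symm]
      exact (hs.isInsertionCorner hd hL).trans_le (hr.row_le _)
    obtain ⟨ur, hur⟩ := hcorner.exists_addsCell
    refine ⟨ur, fun _ j => ?_, fun h => ?_⟩
    · rw [hur j, hs j, hr j]
      have : j ≡ r [ZMOD d] → ¬ j ≡ s [ZMOD d] := fun h h' => hrs (h.symm.trans h')
      split_ifs <;> simp_all
    · exact absurd ((h ▸ hr).modEq hs) hrs

end LocalRules

/-! ### Walks and tableaux -/

section Walks

variable {d L : ℕ}

/-- Each of the shapes `w 1, …, w n` is obtained from the preceding one by adding one cell. -/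
def IsWalk (n : ℕ) (w : ℕ → CylShape d L) : Prop :=
  ∀ k < n, ∃ i, (w k).AddsCell i (w (k + 1))

/-- The step at which the cell `c` is added in the walk `w 0, …, w n`, or `0` if it is not. -/
noncomputable def walkEntry (w : ℕ → CylShape d L) (n : ℕ) (c : Cell d L) : ℕ :=
  sInf {k | k ≤ n ∧ c ∈ (w k).diagram}

/-- The tableau whose walk representation is `w 0, …, w n`. -/
noncomputable def walkTableau (w : ℕ → CylShape d L) (n : ℕ) : Filling d L :=
  ⟨w n, w 0, walkEntry w n⟩

variable {n : ℕ} {w : ℕ → CylShape d L} {c c' : Cell d L} {k l : ℕ}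

theorem IsWalk.of_le (hw : IsWalk n w) (h : l ≤ n) : IsWalk l w :=
  fun k hk => hw k (hk.trans_le h)

theorem IsWalk.subset (hw : IsWalk n w) (hl : l ≤ n) (hkl : k ≤ l) :
    (w k).diagram ⊆ (w l).diagram := by
  induction l, hkl using Nat.le_induction with
  | base => exact subset_rfl
  | succ l hkl ih =>
    obtain ⟨i, hi⟩ := hw l (by omega)
    exact (ih (by omega)).trans hi.subset

theorem walkEntry_le (hk : k ≤ n) (hc : c ∈ (w k).diagram) : walkEntry w n c ≤ k :=
  Nat.sInf_le ⟨hk, hc⟩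

theorem walkEntry_of_mem_zero (hc : c ∈ (w 0).diagram) : walkEntry w n c = 0 :=
  Nat.le_zero.1 (walkEntry_le (Nat.zero_le n) hc)

theorem IsWalk.walkEntry_of_notMem (hw : IsWalk n w) (hc : c ∉ (w n).diagram) :
    walkEntry w n c = 0 := by
  unfold walkEntry
  rw [Nat.sInf_eq_zero]
  refine .inr (Set.eq_empty_of_forall_notMem ?_)
  rintro k ⟨hk, hk'⟩
  exact hc (hw.subset le_rfl hk hk')

theorem walkEntry_le_self (hc : c ∈ (w n).diagram) : walkEntry w n c ≤ n :=
  walkEntry_le le_rfl hc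

theorem mem_walkEntry (hc : c ∈ (w n).diagram) : c ∈ (w (walkEntry w n c)).diagram :=
  (Nat.sInf_mem (s := {k | k ≤ n ∧ c ∈ (w k).diagram}) ⟨n, le_rfl, hc⟩).2

theorem IsWalk.mem_of_walkEntry_le (hw : IsWalk n w) (hc : c ∈ (w n).diagram) (hk : k ≤ n)
    (h : walkEntry w n c ≤ k) : c ∈ (w k).diagram :=
  hw.subset hk h (mem_walkEntry hc)

theorem IsWalk.walkEntry_eq_succ (hw : IsWalk n w) (hk : k < n) (hc : c ∈ (w (k + 1)).diagram)
    (hc' : c ∉ (w k).diagram) : walkEntry w n c = k + 1 := by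
  refine le_antisymm (walkEntry_le hk hc) ?_
  by_contra h
  exact hc' (hw.mem_of_walkEntry_le (hw.subset le_rfl hk hc) hk.le (by omega))

theorem IsWalk.mem_of_walkEntry_pos (hw : IsWalk n w) (h : 0 < walkEntry w n c) :
    c ∈ (w n).diagram := by
  by_contra hc
  simp [hw.walkEntry_of_notMem hc] at h

theorem IsWalk.walkEntry_le_length (hw : IsWalk n w) (c : Cell d L) : walkEntry w n c ≤ n := by
  by_cases hc : c ∈ (w n).diagram
  · exact walkEntry_le_self hc
  · simp [hw.walkEntry_of_notMem hc]

theorem IsWalk.walkEntry_pos_iff (hw : IsWalk n w) :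
    0 < walkEntry w n c ↔ c ∈ (w n).skewDiagram (w 0) := by
  constructor
  · refine fun h => ⟨hw.mem_of_walkEntry_pos h, fun h0 => ?_⟩
    simp [walkEntry_of_mem_zero h0] at h
  · rintro ⟨hn, h0⟩
    by_contra h
    exact h0 (hw.mem_of_walkEntry_le hn (Nat.zero_le n) (by omega))

theorem IsWalk.of_walkEntry_eq_succ (hw : IsWalk n w) (h : walkEntry w n c = k + 1) :
    k < n ∧ c ∈ (w (k + 1)).diagram ∧ c ∉ (w k).diagram := by
  have hn := hw.mem_of_walkEntry_pos (c := c) (by omega)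
  have hk : k < n := by
    have := walkEntry_le_self hn
    omega
  refine ⟨hk, hw.mem_of_walkEntry_le hn hk h.le, fun hc => ?_⟩
  have := walkEntry_le hk.le hc
  omega

theorem IsWalk.walkEntry_injective (hw : IsWalk n w) (h : walkEntry w n c = walkEntry w n c')
    (h0 : walkEntry w n c ≠ 0) : c = c' := by
  obtain ⟨k, hk⟩ := Nat.exists_eq_succ_of_ne_zero h0
  obtain ⟨hkn, h₁, h₂⟩ := hw.of_walkEntry_eq_succ hk
  obtain ⟨-, h₃, h₄⟩ := hw.of_walkEntry_eq_succ (h ▸ hk)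
  obtain ⟨i, hi⟩ := hw k hkn
  rw [hi.eq_of_mem h₁ h₂, hi.eq_of_mem h₃ h₄]

theorem IsWalk.bijOn (hw : IsWalk n w) :
    Set.BijOn (walkEntry w n) ((w n).skewDiagram (w 0)) (Set.Icc 1 n) := by
  refine ⟨fun c hc => ⟨hw.walkEntry_pos_iff.2 hc, hw.walkEntry_le_length c⟩, ?_, ?_⟩
  · intro c hc c' _ h
    exact hw.walkEntry_injective h (hw.walkEntry_pos_iff.2 hc).ne'
  · rintro k ⟨h1, hk⟩
    obtain ⟨k, rfl⟩ : ∃ l, k = l + 1 := ⟨k - 1, by omega⟩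
    obtain ⟨i, hi⟩ := hw k hk
    have h := hw.walkEntry_eq_succ hk hi.mem hi.notMem
    exact ⟨_, hw.walkEntry_pos_iff.1 (by omega), h⟩

theorem IsWalk.skewCard (hw : IsWalk n w) : (w n).skewCard (w 0) = n := by
  have h := hw.bijOn
  unfold CylShape.skewCard
  rw [← h.injOn.ncard_image, h.image_eq, Set.ncard_eq_toFinset_card']
  simp

theorem IsWalk.walkTableau_mem_SCT (hd : 0 < d) (hL : 0 < L) (hw : IsWalk n w) :
    walkTableau w n ∈ SCT (w n) (w 0) := by
  refine ⟨rfl, rfl, hw.subset le_rfl (Nat.zero_le n), ?_, ?_, ?_, ?_⟩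
  · rw [hw.skewCard]
    exact hw.bijOn
  · intro c hc
    by_contra h
    exact hc (hw.walkEntry_pos_iff.1 (Nat.pos_of_ne_zero h))
  all_goals
    intro i j h h'
    change walkEntry w n _ < walkEntry w n _
    obtain ⟨k, hk⟩ := Nat.exists_eq_succ_of_ne_zero (hw.walkEntry_pos_iff.2 h').ne'
    obtain ⟨hkn, h₁, -⟩ := hw.of_walkEntry_eq_succ hk
    rw [CylShape.cell_mem_diagram] at h₁
    -- The upper or left neighbour lies in every shape containing the later cell, so its entry is at
    -- most as large; injectivity of the entries makes this strict.
    have hc : cell i j ∈ (w (k + 1)).diagram :=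
      CylShape.cell_mem_diagram.2 (by have := (w (k + 1)).anti (show i ≤ i + 1 by omega); omega)
    refine lt_of_le_of_ne (hk ▸ walkEntry_le hkn hc) fun he => ?_
    have hcell := hw.walkEntry_injective he (hw.walkEntry_pos_iff.2 h).ne'
  · obtain ⟨t, ht, ht'⟩ := cell_eq_cell_iff.1 hcell
    have : t = 0 := by
      rcases mul_eq_zero.1 (show t * (L : ℤ) = 0 by linarith) with h | h <;> omega
    simp [this] at ht
  · have := (cell_row_eq_cell_row_iff hd).1 hcell
    omega

theorem IsWalk.isWalkRep_iff (hw : IsWalk n w) {u : Fin (n + 1) → CylShape d L} :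
    IsWalkRep (walkTableau w n) n u ↔ ∀ k, u k = w k := by
  have key : ∀ k ≤ n, (w k).diagram =
      (w 0).diagram ∪ {c | 1 ≤ walkEntry w n c ∧ walkEntry w n c ≤ k} := by
    intro k hk
    ext c
    constructor
    · intro hc
      by_cases h0 : c ∈ (w 0).diagram
      · exact .inl h0
      · exact .inr ⟨hw.walkEntry_pos_iff.2 ⟨hw.subset le_rfl hk hc, h0⟩, walkEntry_le hk hc⟩
    · rintro (hc | ⟨h1, h2⟩)
      · exact hw.subset hk (Nat.zero_le k) hc
      · exact hw.mem_of_walkEntry_le (hw.mem_of_walkEntry_pos h1) hk h2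
  constructor
  · rintro ⟨-, h⟩ k
    apply CylShape.diagram_injective
    rw [h k, key k (Nat.lt_succ_iff.1 k.2)]
    rfl
  · intro h
    refine ⟨hw.skewCard, fun k => ?_⟩
    rw [h k, key k (Nat.lt_succ_iff.1 k.2)]
    rfl

/-- For a skew cell, lying in `w k` means having entry at most `k` in `F`, so that entry is the
first step at which the cell appears. -/
theorem IsWalk.eq_walkTableau (hw : IsWalk n w) {F : Filling d L} (hF : F ∈ SCT (w n) (w 0))
    (h : IsWalkRep F n fun k => w k) : F = walkTableau w n := by
  obtain ⟨ho, hi, -, hbij, hzero, -, -⟩ := hF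
  obtain ⟨-, h⟩ := h
  ext1
  · exact ho
  · exact hi
  · ext c
    change F.entry c = walkEntry w n c
    by_cases hc : c ∈ (w n).skewDiagram (w 0)
    · have hpos := (hbij.mapsTo hc)
      rw [hw.skewCard] at hpos
      have hk : ∀ k ≤ n, c ∈ (w k).diagram ↔ F.entry c ≤ k := by
        intro k hk
        have := h ⟨k, Nat.lt_succ_iff.2 hk⟩
        dsimp only at this
        rw [this, hi]
        constructor
        · rintro (h0 | h1)
          · exact absurd h0 hc.2
          · exact h1.2
        · exact fun h1 => .inr ⟨hpos.1, h1⟩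
      refine le_antisymm ?_ ?_
      · exact (hk _ (walkEntry_le_self hc.1)).1 (mem_walkEntry hc.1)
      · exact walkEntry_le hpos.2 ((hk _ hpos.2).2 le_rfl)
    · rw [hzero c hc]
      by_contra h0
      exact hc (hw.walkEntry_pos_iff.1 (Nat.pos_of_ne_zero fun h => h0 h.symm))

/-- Every standard tableau comes from a walk. -/
theorem exists_walk_of_mem_SCT {lam mu : CylShape d L} {T : Filling d L} (hT : T ∈ SCT lam mu)
    (hn : lam.skewCard mu = n) :
    ∃ w : ℕ → CylShape d L, IsWalk n w ∧ T = walkTableau w n ∧ w 0 = mu ∧ w n = lam := by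
  have hT' := hT
  obtain ⟨ho, hi, hsub, hbij, hzero, hcol, hrow⟩ := hT
  rw [hn] at hbij
  have hskew : ∀ c, 1 ≤ T.entry c → c ∈ lam.skewDiagram mu := by
    intro c hc
    by_contra h
    have := hzero c h
    omega
  -- The left and upper neighbours of the cell with entry `k + 1` are in `mu` or have smaller
  -- entries, so they lie in `nu` and that cell sits at a corner.
  have hstep : ∀ k < n, ∀ nu : CylShape d L,
      nu.diagram = mu.diagram ∪ {c | 1 ≤ T.entry c ∧ T.entry c ≤ k} →
      ∃ i nu', nu.AddsCell i nu' ∧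
        nu'.diagram = mu.diagram ∪ {c | 1 ≤ T.entry c ∧ T.entry c ≤ k + 1} := by
    intro k hk nu hnu
    obtain ⟨c, hc, hck⟩ := hbij.surjOn (show k + 1 ∈ Set.Icc 1 n from ⟨by omega, hk⟩)
    obtain ⟨i, j, rfl⟩ := exists_eq_cell c
    have hmem : ∀ c', c' ∈ lam.diagram →
        (c' ∈ lam.skewDiagram mu → T.entry c' < k + 1) → c' ∈ nu.diagram := by
      intro c' h₁ h₂
      rw [hnu]
      by_cases h : c' ∈ mu.diagram
      · exact .inl h
      · exact .inr ⟨(hbij.mapsTo ⟨h₁, h⟩).1, Nat.lt_succ_iff.1 (h₂ ⟨h₁, h⟩)⟩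
    have hnot : cell i j ∉ nu.diagram := by
      rw [hnu]
      rintro (h | h)
      · exact hc.2 h
      · have := h.2
        omega
    have hjl := CylShape.cell_mem_diagram.1 hc.1
    have hleft : cell i (j - 1) ∈ nu.diagram := by
      refine hmem _ (CylShape.cell_mem_diagram.2 (by omega)) fun h => ?_
      have := hrow i (j - 1) h (by rwa [sub_add_cancel])
      rwa [sub_add_cancel, hck] at this
    have hup : cell (i - 1) j ∈ nu.diagram := by
      refine hmem _ (CylShape.cell_mem_diagram.2 (hjl.trans (lam.anti (by omega)))) fun h => ?_
      have := hcol (i - 1) j h (by rwa [sub_add_cancel])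
      rwa [sub_add_cancel, hck] at this
    rw [CylShape.cell_mem_diagram] at hnot hleft hup
    have hcorner : nu.IsInsertionCorner i := by
      unfold CylShape.IsInsertionCorner
      omega
    obtain ⟨nu', hnu'⟩ := hcorner.exists_addsCell
    refine ⟨i, nu', hnu', ?_⟩
    rw [hnu'.diagram_eq, show nu.row i + 1 = j by omega, hnu]
    ext c'
    simp only [Set.mem_insert_iff, Set.mem_union, Set.mem_ofPred_eq]
    constructor
    · rintro (rfl | h | h)
      · exact .inr (by omega)
      · exact .inl h
      · exact .inr (by omega)
    · rintro (h | ⟨h₁, h₂⟩)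
      · exact .inr (.inl h)
      · rcases h₂.lt_or_eq with h | h
        · exact .inr (.inr ⟨h₁, by omega⟩)
        · exact .inl (hbij.injOn (hskew _ h₁) hc (h.trans hck.symm))
  -- The bound `k ≤ n` is placed under the existential so that `choose` gives a total sequence; its
  -- values beyond `n` are irrelevant.
  have hex : ∀ k, ∃ nu : CylShape d L, k ≤ n →
      nu.diagram = mu.diagram ∪ {c | 1 ≤ T.entry c ∧ T.entry c ≤ k} := by
    intro k
    induction k with
    | zero =>
      refine ⟨mu, fun _ => ?_⟩
      rw [eq_comm, Set.union_eq_left]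
      rintro c ⟨h₁, h₂⟩
      omega
    | succ k ih =>
      obtain ⟨nu, hnu⟩ := ih
      by_cases hk : k < n
      · obtain ⟨i, nu', -, h⟩ := hstep k hk nu (hnu hk.le)
        exact ⟨nu', fun _ => h⟩
      · exact ⟨nu, fun h => absurd h hk⟩
  choose w hw using hex
  have hwalk : IsWalk n w := by
    intro k hk
    obtain ⟨i, nu', h, hd⟩ := hstep k hk (w k) (hw k hk.le)
    rw [← hw (k + 1) hk] at hd
    exact ⟨i, CylShape.diagram_injective hd ▸ h⟩
  have h0 : w 0 = mu := by
    apply CylShape.diagram_injective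
    rw [hw 0 (Nat.zero_le n), Set.union_eq_left]
    rintro c ⟨h₁, h₂⟩
    omega
  have hlast : w n = lam := by
    apply CylShape.diagram_injective
    rw [hw n le_rfl]
    ext c
    constructor
    · rintro (h | h)
      · exact hsub h
      · exact (hskew c h.1).1
    · intro h
      by_cases hm : c ∈ mu.diagram
      · exact .inl hm
      · exact .inr (hbij.mapsTo ⟨h, hm⟩)
  refine ⟨w, hwalk, ?_, h0, hlast⟩
  refine hwalk.eq_walkTableau (by rwa [h0, hlast]) ⟨by rw [ho, hi, hn], fun k => ?_⟩
  rw [hi]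
  exact hw k (Nat.lt_succ_iff.1 k.2)

end Walks

/-! ### One column of a growth diagram -/

section Columns

variable {d L : ℕ}

open Classical in
/-- The label of the upper right vertex of a square, if the forward rule determines it. -/
noncomputable def upperRight (ll ul lr : CylShape d L) : CylShape d L :=
  if h : ∃ ur, ForwardRule ll ul lr ur then h.choose else ll

theorem forwardRule_upperRight (hd : 0 < d) (hL : 0 < L) {ll ul lr : CylShape d L} {r s : ℤ}
    (hs : ll.AddsCell s ul) (hr : ll.AddsCell r lr) :
    ForwardRule ll ul lr (upperRight ll ul lr) := by
  have h := exists_forwardRule hd hL hs hr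
  rw [upperRight, dif_pos h]
  exact h.choose_spec

/-- The labels to the right of the labels `w 0, w 1, …`, starting with `b`. -/
noncomputable def growthColumn (w : ℕ → CylShape d L) (b : CylShape d L) : ℕ → CylShape d L
  | 0 => b
  | k + 1 => upperRight (w k) (w (k + 1)) (growthColumn w b k)

/-- `w 0, …, w n` and `v 0, …, v n` are adjacent columns of a growth diagram. -/
structure IsColumnPair (n : ℕ) (w v : ℕ → CylShape d L) : Prop where
  walk : IsWalk n w
  start : ∃ i, (w 0).AddsCell i (v 0)
  rule : ∀ k < n, ForwardRule (w k) (w (k + 1)) (v k) (v (k + 1))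

/-- The invariant that right and left labels differ by one added cell is what makes the forward rule
applicable to the next square. -/
theorem isColumnPair_growthColumn (hd : 0 < d) (hL : 0 < L) {n : ℕ} {w : ℕ → CylShape d L}
    {b : CylShape d L} (hw : IsWalk n w) (hb : ∃ i, (w 0).AddsCell i b) :
    IsColumnPair n w (growthColumn w b) := by
  suffices h : ∀ k ≤ n, (∃ r, (w k).AddsCell r (growthColumn w b k)) by
    refine ⟨hw, hb, fun k hk => ?_⟩
    obtain ⟨s, hs⟩ := hw k hk
    obtain ⟨r, hr⟩ := h k hk.le
    exact forwardRule_upperRight hd hL hs hr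
  intro k hk
  induction k with
  | zero => exact hb
  | succ k ih =>
    obtain ⟨s, hs⟩ := hw k hk
    obtain ⟨r, hr⟩ := ih (by omega)
    have h := forwardRule_upperRight hd hL hs hr
    by_cases hrs : r ≡ s [ZMOD d]
    · obtain ⟨h₁, h₂⟩ := h.addsCell_of_modEq hs hr hrs
      exact ⟨r + 1, by rw [h₁]; exact h₂⟩
    · exact ⟨r, (h.addsCell_of_not_modEq hs hr hrs).2⟩

namespace IsColumnPair

variable {n : ℕ} {w v : ℕ → CylShape d L}

/-- The row of the extra cell stays the same or moves from `r` to `r + 1`; this is the bumping path.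
-/
theorem exists_addsCell (h : IsColumnPair n w v) {k : ℕ} (hk : k ≤ n) :
    ∃ r, (w k).AddsCell r (v k) := by
  induction k with
  | zero => exact h.start
  | succ k ih =>
    obtain ⟨s, hs⟩ := h.walk k hk
    obtain ⟨r, hr⟩ := ih (by omega)
    have h' := h.rule k hk
    by_cases hrs : r ≡ s [ZMOD d]
    · obtain ⟨h₁, h₂⟩ := h'.addsCell_of_modEq hs hr hrs
      exact ⟨r + 1, h₁ ▸ h₂⟩
    · exact ⟨r, (h'.addsCell_of_not_modEq hs hr hrs).2⟩

theorem walk_right (h : IsColumnPair n w v) : IsWalk n v := by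
  intro k hk
  obtain ⟨s, hs⟩ := h.walk k hk
  obtain ⟨r, hr⟩ := h.exists_addsCell hk.le
  by_cases hrs : r ≡ s [ZMOD d]
  · exact ⟨r + 1, ((h.rule k hk).addsCell_of_modEq hs hr hrs).2⟩
  · exact ⟨s, ((h.rule k hk).addsCell_of_not_modEq hs hr hrs).1⟩

end IsColumnPair

/-! ### Insertion along a column -/

open Classical in
/-- The entries when the steps `1, …, k` of `w` have been replaced by those of `v`. -/
noncomputable def mixedEntry (w v : ℕ → CylShape d L) (n k : ℕ) (c : Cell d L) : ℕ :=
  if c ∈ (w k).diagram then walkEntry v n c else walkEntry w n c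

variable {n : ℕ} {w v : ℕ → CylShape d L} {k : ℕ} {c : Cell d L}

theorem mixedEntry_of_mem (hc : c ∈ (w k).diagram) : mixedEntry w v n k c = walkEntry v n c :=
  if_pos hc

theorem mixedEntry_of_notMem (hc : c ∉ (w k).diagram) : mixedEntry w v n k c = walkEntry w n c :=
  if_neg hc

theorem mixedEntry_succ_of_ne {s : ℤ}
    (hs : (w k).AddsCell s (w (k + 1))) (hc : c ≠ cell s ((w k).row s + 1)) :
    mixedEntry w v n (k + 1) c = mixedEntry w v n k c := by
  by_cases h : c ∈ (w k).diagram
  · rw [mixedEntry_of_mem h, mixedEntry_of_mem (hs.subset h)]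
  · rw [mixedEntry_of_notMem h, mixedEntry_of_notMem fun h' => hc (hs.eq_of_mem h' h)]

open Classical in
theorem mixedEntry_succ {s : ℤ}
    (hs : (w k).AddsCell s (w (k + 1))) :
    mixedEntry w v n (k + 1) = Function.update (mixedEntry w v n k) (cell s ((w k).row s + 1))
      (walkEntry v n (cell s ((w k).row s + 1))) := by
  ext c
  by_cases hc : c = cell s ((w k).row s + 1)
  · subst hc
    rw [Function.update_self, mixedEntry_of_mem hs.mem]
  · rw [Function.update_of_ne hc, mixedEntry_succ_of_ne hs hc]

/-- Both columns add the same cell at step `k + 1`, so its entry is `k + 1` in either tableau. -/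
theorem IsColumnPair.mixedEntry_succ_of_not_modEq (h : IsColumnPair n w v) (hk : k < n) {r s : ℤ}
    (hs : (w k).AddsCell s (w (k + 1))) (hr : (w k).AddsCell r (v k))
    (hrs : ¬ r ≡ s [ZMOD d]) : mixedEntry w v n (k + 1) = mixedEntry w v n k := by
  ext c
  by_cases hc : c = cell s ((w k).row s + 1)
  · subst hc
    obtain ⟨hs', -⟩ := (h.rule k hk).addsCell_of_not_modEq hs hr hrs
    have hrow : (v k).row s = (w k).row s := hr.row_of_not_modEq fun h => hrs h.symm
    rw [mixedEntry_of_mem hs.mem, mixedEntry_of_notMem hs.notMem,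
      h.walk.walkEntry_eq_succ hk hs.mem hs.notMem,
      h.walk_right.walkEntry_eq_succ hk (hrow ▸ hs'.mem) (hrow ▸ hs'.notMem)]
  · exact mixedEntry_succ_of_ne hs hc

/-- The number in hand is the entry that `v` gives to the extra cell of `v k`. The hypothesis `hgap`
says that every larger entry of row `r` exceeds `k`, so the first later step of `w` in row `r` is
the one bumped; if there is none, the number goes to the end of the row. -/
theorem IsColumnPair.rowInsert (h : IsColumnPair n w v) (hc : c ∈ (v n).diagram)
    (hc' : c ∉ (w n).diagram) (hk : k ≤ n) {r : ℤ} (hr : (w k).AddsCell r (v k))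
    (hpos : 0 < walkEntry v n (cell r ((w k).row r + 1)))
    (hgap : ∀ j, walkEntry v n (cell r ((w k).row r + 1)) < mixedEntry w v n k (cell r j) →
      k < mixedEntry w v n k (cell r j)) :
    RowInsert ⟨w n, v 0, mixedEntry w v n k⟩ r (walkEntry v n (cell r ((w k).row r + 1)))
      (walkTableau v n) c := by
  classical
  have hv := h.walk_right
  induction hk using Nat.decreasingInduction generalizing r with
  | self =>
    obtain rfl : c = cell r ((w n).row r + 1) := hr.eq_of_mem hc hc'
    set a := walkEntry v n (cell r ((w n).row r + 1)) with ha
    have hG : walkTableau v n =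
        { (⟨w n, v 0, mixedEntry w v n n⟩ : Filling d L).setEntry
            (cell r ((w n).row r + 1)) a with outer := v n } := by
      ext1
      · rfl
      · rfl
      · ext c
        simp only [walkTableau, Filling.setEntry]
        by_cases hcr : c = cell r ((w n).row r + 1)
        · subst hcr
          rw [Function.update_self]
        · rw [Function.update_of_ne hcr]
          by_cases hcw : c ∈ (w n).diagram
          · rw [mixedEntry_of_mem hcw]
          · rw [mixedEntry_of_notMem hcw, h.walk.walkEntry_of_notMem hcw,
              hv.walkEntry_of_notMem fun hcv => hcr (hr.eq_of_mem hcv hcw)]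
    rw [hG]
    refine RowInsert.place _ r a (v n) (fun j => ?_) hr
    change mixedEntry w v n n (cell r j) < a
    have hle : mixedEntry w v n n (cell r j) ≤ n := by
      unfold mixedEntry
      split_ifs
      · exact hv.walkEntry_le_length _
      · exact h.walk.walkEntry_le_length _
    -- A larger entry would exceed `n` by `hgap`. An equal one would, by injectivity, put the new
    -- cell in `w n`, or else would be `0`, against `hpos`.
    refine lt_of_le_of_ne (not_lt.1 fun hlt => (hgap j hlt).not_ge hle) fun he => ?_
    by_cases hcw : cell r j ∈ (w n).diagram
    · rw [mixedEntry_of_mem hcw] at he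
      exact hc' (hv.walkEntry_injective he (by omega) ▸ hcw)
    · rw [mixedEntry_of_notMem hcw, h.walk.walkEntry_of_notMem hcw] at he
      omega
  | of_succ k hk ih =>
    obtain ⟨s, hs⟩ := h.walk k hk
    by_cases hrs : r ≡ s [ZMOD d]
    · replace hs := hs.congr hrs.symm
      obtain ⟨heq, hr'⟩ := (h.rule k hk).addsCell_of_modEq hs hr (Int.ModEq.refl r)
      have hr'' : (w (k + 1)).AddsCell (r + 1) (v (k + 1)) := heq ▸ hr'
      have hentry : mixedEntry w v n k (cell r ((w k).row r + 1)) = k + 1 := by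
        rw [mixedEntry_of_notMem hs.notMem, h.walk.walkEntry_eq_succ hk hs.mem hs.notMem]
      have hnext : walkEntry v n (cell (r + 1) ((w (k + 1)).row (r + 1) + 1)) = k + 1 :=
        hv.walkEntry_eq_succ hk hr''.mem (heq ▸ hr''.notMem)
      have hle : walkEntry v n (cell r ((w k).row r + 1)) ≤ k := walkEntry_le hk.le hr.mem
      -- The extra cell of `v k` is the one `w` fills with `k + 1`, which by `hgap` is the least
      -- entry of row `r` above the number in hand.
      refine RowInsert.bump _ r _ ((w k).row r + 1) _ _ ?_ ?_ ?_
      · change _ < mixedEntry w v n k _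
        omega
      · intro j hj
        change mixedEntry w v n k _ ≤ _
        rw [hentry]
        exact hgap j hj
      -- The number now in hand is `k + 1` itself, so the gap condition at level `k + 1` is a
      -- tautology.
      · have := ih hr'' (by omega) (fun j => by rw [hnext]; exact id)
        rw [hnext, mixedEntry_succ hs] at this
        change RowInsert _ _ (mixedEntry w v n k _) _ _
        rw [hentry]
        exact this
    · obtain ⟨hs', hr'⟩ := (h.rule k hk).addsCell_of_not_modEq hs hr hrs
      have hrow : (w (k + 1)).row r = (w k).row r := hs.row_of_not_modEq hrs
      have hmix := h.mixedEntry_succ_of_not_modEq hk hs hr hrs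
      rw [← hmix, ← hrow]
      refine ih hr' (by rwa [hrow]) fun j hj => ?_
      rw [hrow, hmix] at hj
      have hlt := hgap j hj
      rw [← hmix] at hlt
      -- The value `k + 1` cannot occur in row `r`: in `v` it sits in row `s`, and in `w` its cell
      -- belongs to `w (k + 1)`.
      refine lt_of_le_of_ne hlt fun he => ?_
      by_cases hcw : cell r j ∈ (w (k + 1)).diagram
      · rw [mixedEntry_of_mem hcw] at he
        obtain ⟨-, h₁, h₂⟩ := hv.of_walkEntry_eq_succ he.symm
        exact hrs (modEq_of_cell_eq (hs'.eq_of_mem h₁ h₂))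
      · rw [mixedEntry_of_notMem hcw] at he
        exact hcw (h.walk.of_walkEntry_eq_succ he.symm).2.1

-- This is the start of an internal insertion: `hzero` holds at height `0` since the extra cell
-- joins the inner shape. The first step of `w` in row `r` gives the entry removed and passed to row
-- `r + 1`; if there is none, inner and outer shape gain the same cell.
open Classical in
theorem IsColumnPair.rowInsert_or_eq (h : IsColumnPair n w v) (hc : c ∈ (v n).diagram)
    (hc' : c ∉ (w n).diagram) (hk : k ≤ n) {r : ℤ} (hr : (w k).AddsCell r (v k))
    (hzero : walkEntry v n (cell r ((w k).row r + 1)) = 0) :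
    ((w k).row r < (w n).row r ∧
      RowInsert ⟨w n, v 0, Function.update (mixedEntry w v n k) (cell r ((w k).row r + 1)) 0⟩
        (r + 1) (mixedEntry w v n k (cell r ((w k).row r + 1))) (walkTableau v n) c) ∨
    ((w k).row r = (w n).row r ∧ (w n).AddsCell r (v n) ∧
      mixedEntry w v n k = walkEntry v n ∧ c = cell r ((w n).row r + 1)) := by
  have hv := h.walk_right
  induction hk using Nat.decreasingInduction generalizing r with
  | self =>
    refine .inr ⟨rfl, hr, ?_, hr.eq_of_mem hc hc'⟩
    ext c
    by_cases hcw : c ∈ (w n).diagram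
    · rw [mixedEntry_of_mem hcw]
    · rw [mixedEntry_of_notMem hcw, h.walk.walkEntry_of_notMem hcw]
      by_cases hcv : c ∈ (v n).diagram
      · rw [hr.eq_of_mem hcv hcw, hzero]
      · rw [hv.walkEntry_of_notMem hcv]
  | of_succ k hk ih =>
    obtain ⟨s, hs⟩ := h.walk k hk
    by_cases hrs : r ≡ s [ZMOD d]
    · replace hs := hs.congr hrs.symm
      obtain ⟨heq, hr'⟩ := (h.rule k hk).addsCell_of_modEq hs hr (Int.ModEq.refl r)
      have hr'' : (w (k + 1)).AddsCell (r + 1) (v (k + 1)) := heq ▸ hr'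
      have hentry : mixedEntry w v n k (cell r ((w k).row r + 1)) = k + 1 := by
        rw [mixedEntry_of_notMem hs.notMem, h.walk.walkEntry_eq_succ hk hs.mem hs.notMem]
      have hnext : walkEntry v n (cell (r + 1) ((w (k + 1)).row (r + 1) + 1)) = k + 1 :=
        hv.walkEntry_eq_succ hk hr''.mem (heq ▸ hr''.notMem)
      refine .inl ⟨?_, ?_⟩
      · have h₁ := hs.row_self
        have h₂ := CylShape.diagram_subset_iff.1 (h.walk.subset le_rfl hk) r
        simp only [Nat.succ_eq_add_one] at h₂
        omega
      · have := h.rowInsert (k := k + 1) hc hc' hk hr'' (by omega) (fun j => by rw [hnext]; exact id)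
        rw [hnext, mixedEntry_succ hs, hzero] at this
        rw [hentry]
        exact this
    · obtain ⟨hs', hr'⟩ := (h.rule k hk).addsCell_of_not_modEq hs hr hrs
      have hrow : (w (k + 1)).row r = (w k).row r := hs.row_of_not_modEq hrs
      rw [← h.mixedEntry_succ_of_not_modEq hk hs hr hrs, ← hrow]
      exact ih hr' (by rwa [hrow])

/-- Internal insertion turns a column of a growth diagram into the next one. -/
theorem IsColumnPair.isInsertion (hd : 0 < d) (hL : 0 < L) (h : IsColumnPair n w v) {i : ℤ}
    (hi : (w 0).AddsCell i (v 0)) (hc : c ∈ (v n).diagram) (hc' : c ∉ (w n).diagram) :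
    IsInsertion i (walkTableau w n) (walkTableau v n) c := by
  classical
  have hmix : mixedEntry w v n 0 = walkEntry w n := by
    ext c
    by_cases hc : c ∈ (w 0).diagram
    · rw [mixedEntry_of_mem hc, walkEntry_of_mem_zero hc, walkEntry_of_mem_zero (hi.subset hc)]
    · exact mixedEntry_of_notMem hc
  refine ⟨hi.isInsertionCorner hd hL, v 0, hi, ?_⟩
  rcases h.rowInsert_or_eq hc hc' (Nat.zero_le n) hi (walkEntry_of_mem_zero hi.mem) with
    ⟨h₁, h₂⟩ | ⟨h₁, h₂, h₃, h₄⟩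
  · rw [hmix] at h₂
    exact .inl ⟨h₁, h₂⟩
  · rw [hmix] at h₃
    refine .inr ⟨h₁, v n, h₂, ?_, h₄⟩
    rw [walkTableau, ← h₃]
    rfl

end Columns

/-! ### Insertion is deterministic -/

section Determinism

variable {d L : ℕ}

/-- No positive entry occurs twice. -/
def Filling.Distinct (F : Filling d L) : Prop :=
  ∀ c c', F.entry c = F.entry c' → F.entry c ≠ 0 → c = c'

theorem RowInsert.unique {F G G' : Filling d L} {r r' : ℤ} {a : ℕ} {c c' : Cell d L}
    (h : RowInsert F r a G c) (h' : RowInsert F r' a G' c') (hr : r ≡ r' [ZMOD d])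
    (hF : F.Distinct) (ha : ∀ c, F.entry c ≠ a) : G = G' ∧ c = c' := by
  induction h generalizing r' with
  | place F r a nu largest hnu =>
    cases h' with
    | place _ _ _ nu' largest' hnu' =>
      rw [F.outer.cell_row_congr hr 1, (hnu.congr hr).unique hnu']
      exact ⟨rfl, rfl⟩
    | bump _ _ _ j _ _ larger =>
      obtain ⟨s, hs⟩ := exists_shift_of_modEq (L := L) hr.symm
      have := largest (j + s)
      rw [hs] at this
      omega
  | bump F r a j G c larger smallest next ih =>
    obtain ⟨s, hs⟩ := exists_shift_of_modEq (L := L) hr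
    obtain ⟨s', hs'⟩ := exists_shift_of_modEq (L := L) hr.symm
    cases h' with
    | place _ _ _ nu' largest' hnu' =>
      have := largest' (j + s)
      rw [hs] at this
      omega
    | bump _ _ _ j' _ _ larger' smallest' next' =>
      have h₁ := smallest (j' + s')
      have h₂ := smallest' (j + s)
      rw [hs'] at h₁
      rw [hs] at h₂
      have hcell : (cell r j : Cell d L) = cell r' j' :=
        hF _ _ (le_antisymm (h₁ larger') (h₂ larger)) (by omega)
      rw [← hcell] at next'
      refine ih next' (hr.add_right 1) ?_ ?_
      · intro c₁ c₂ he h0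
        simp only [Filling.setEntry] at he h0
        by_cases h1 : c₁ = cell r j <;> by_cases h2 : c₂ = cell r j
        · rw [h1, h2]
        · rw [h1, Function.update_self, Function.update_of_ne h2] at he
          exact absurd he.symm (ha c₂)
        · rw [h2, Function.update_self, Function.update_of_ne h1] at he
          exact absurd he (ha c₁)
        · rw [Function.update_of_ne h1] at he h0
          rw [Function.update_of_ne h2] at he
          exact hF _ _ he h0
      · intro c₁ he
        simp only [Filling.setEntry] at he
        by_cases h1 : c₁ = cell r j
        · rw [h1, Function.update_self] at he
          omega
        · rw [Function.update_of_ne h1] at he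
          exact h1 (hF _ _ he (by omega))

/-- By `hpos` the removed entry is nonzero, so once its cell is emptied it occurs nowhere, as
`RowInsert.unique` requires. -/
theorem IsInsertion.unique {T T' T'' : Filling d L} {i i' : ℤ} {c c' : Cell d L}
    (h : IsInsertion i T T' c) (h' : IsInsertion i' T T'' c') (hi : i ≡ i' [ZMOD d])
    (hT : T.Distinct) (hpos : ∀ j, T.inner.row j < T.outer.row j →
      T.entry (cell j (T.inner.row j + 1)) ≠ 0) : T' = T'' ∧ c = c' := by
  obtain ⟨-, nu, hnu, h⟩ := h
  obtain ⟨-, nu', hnu', h'⟩ := h'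
  obtain rfl := (hnu.congr hi).unique hnu'
  have hlt : T.inner.row i < T.outer.row i ↔ T.inner.row i' < T.outer.row i' := by
    obtain ⟨t, ht⟩ := Int.modEq_iff_dvd.1 hi
    obtain rfl : i' = i - (-t) * d := by linarith
    rw [CylShape.row_sub_mul, CylShape.row_sub_mul]
    omega
  have hcell := T.inner.cell_row_congr hi 1
  rcases h with ⟨h₁, h₂⟩ | ⟨h₁, nu₁, h₂, rfl, rfl⟩ <;>
    rcases h' with ⟨h₁', h₂'⟩ | ⟨h₁', nu₂, h₂', rfl, rfl⟩
  · rw [← hcell] at h₂'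
    have hne := hpos i h₁
    refine h₂.unique h₂' (hi.add_right 1) ?_ ?_
    · intro c₁ c₂ he h0
      simp only [Filling.setEntry] at he h0
      have h1 : c₁ ≠ cell i (T.inner.row i + 1) := by
        rintro rfl
        exact h0 (Function.update_self ..)
      rw [Function.update_of_ne h1] at he h0
      have h2 : c₂ ≠ cell i (T.inner.row i + 1) := by
        rintro rfl
        rw [Function.update_self] at he
        exact h0 he
      rw [Function.update_of_ne h2] at he
      exact hT _ _ he h0
    · intro c₁ he
      simp only [Filling.setEntry] at he
      by_cases h1 : c₁ = cell i (T.inner.row i + 1)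
      · rw [h1, Function.update_self] at he
        exact hne he.symm
      · rw [Function.update_of_ne h1] at he
        exact h1 (hT _ _ he (he ▸ hne))
  · omega
  · omega
  · rw [(h₂.congr hi).unique h₂', T.outer.cell_row_congr hi 1]
    exact ⟨rfl, rfl⟩

theorem PlacesAt.unique {F G G' : Filling d L} {c : Cell d L} {k : ℕ} (h : PlacesAt F c k G)
    (h' : PlacesAt F c k G') : G = G' := by
  obtain ⟨-, h₁, h₂, h₃⟩ := h
  obtain ⟨-, h₁', h₂', h₃'⟩ := h'
  ext1
  · exact CylShape.diagram_injective (h₁.trans h₁'.symm)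
  · exact h₂.trans h₂'.symm
  · exact h₃.trans h₃'.symm

theorem IsWalk.distinct {n : ℕ} {w : ℕ → CylShape d L} (hw : IsWalk n w) :
    (walkTableau w n).Distinct :=
  fun _ _ h h0 => hw.walkEntry_injective h h0

theorem IsWalk.entry_ne_zero {n : ℕ} {w : ℕ → CylShape d L} (hw : IsWalk n w) (j : ℤ)
    (hj : (w 0).row j < (w n).row j) : walkEntry w n (cell j ((w 0).row j + 1)) ≠ 0 := by
  refine (hw.walkEntry_pos_iff.2 ⟨?_, ?_⟩).ne' <;> rw [CylShape.cell_mem_diagram] <;> omega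

end Determinism

/-! ### The growth diagram and the insertion map -/

section Grid

variable {d L : ℕ}

/-- The labels of the growth diagram with left boundary `t` and bottom boundary `u`. -/
noncomputable def growthGrid (t u : ℕ → CylShape d L) : ℕ → ℕ → CylShape d L
  | 0 => t
  | x + 1 => growthColumn (growthGrid t u x) (u (x + 1))

variable {m n : ℕ} {t u : ℕ → CylShape d L}

theorem growthGrid_zero_right (h0 : t 0 = u 0) (x : ℕ) : growthGrid t u x 0 = u x := by
  cases x with
  | zero => exact h0
  | succ x => rfl

theorem IsWalk.growthGrid (hd : 0 < d) (hL : 0 < L) (ht : IsWalk n t) (hu : IsWalk m u)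
    (h0 : t 0 = u 0) {x : ℕ} (hx : x ≤ m) : IsWalk n (growthGrid t u x) := by
  induction x with
  | zero => exact ht
  | succ x ih =>
    refine (isColumnPair_growthColumn hd hL (ih (by omega)) ?_).walk_right
    rw [growthGrid_zero_right h0]
    exact hu x hx

theorem isColumnPair_growthGrid (hd : 0 < d) (hL : 0 < L) (ht : IsWalk n t) (hu : IsWalk m u)
    (h0 : t 0 = u 0) {x : ℕ} (hx : x < m) :
    IsColumnPair n (growthGrid t u x) (growthGrid t u (x + 1)) := by
  refine isColumnPair_growthColumn hd hL (ht.growthGrid hd hL hu h0 hx.le) ?_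
  rw [growthGrid_zero_right h0]
  exact hu x hx

theorem isWalk_growthGrid_top (hd : 0 < d) (hL : 0 < L) (ht : IsWalk n t) (hu : IsWalk m u)
    (h0 : t 0 = u 0) : IsWalk m fun x => growthGrid t u x n :=
  fun _ hx => (isColumnPair_growthGrid hd hL ht hu h0 hx).exists_addsCell le_rfl

theorem isGrowthDiagram_iff (hd : 0 < d) (hL : 0 < L) (ht : IsWalk n t) (hu : IsWalk m u)
    (h0 : t 0 = u 0) {rho : Fin (m + 1) → Fin (n + 1) → CylShape d L} :
    IsGrowthDiagram m n (walkTableau t n) (walkTableau u m) rho ↔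
      rho = fun (x : Fin (m + 1)) (y : Fin (n + 1)) => growthGrid t u x y := by
  unfold IsGrowthDiagram
  rw [ht.isWalkRep_iff, hu.isWalkRep_iff]
  constructor
  · rintro ⟨hleft, hbot, hrule⟩
    suffices h : ∀ (x : ℕ) (hx : x < m + 1) (y : ℕ) (hy : y < n + 1),
        rho ⟨x, hx⟩ ⟨y, hy⟩ = growthGrid t u x y by
      ext1 x
      ext1 y
      exact h x x.2 y y.2
    intro x
    induction x with
    | zero => exact fun _ y hy => hleft ⟨y, hy⟩
    | succ x ihx =>
      intro hx y
      induction y with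
      | zero => exact fun _ => hbot ⟨x + 1, hx⟩
      | succ y ihy =>
        intro hy
        have h₁ := hrule ⟨x, by omega⟩ ⟨y, by omega⟩
        have h₂ := (isColumnPair_growthGrid hd hL ht hu h0 (show x < m by omega)).rule y (by omega)
        rw [← ihx (by omega) y (by omega), ← ihx (by omega) (y + 1) hy, ← ihy (by omega)] at h₂
        exact h₁.unique h₂
  · rintro rfl
    refine ⟨fun y => rfl, fun x => growthGrid_zero_right h0 x, fun x y => ?_⟩
    exact (isColumnPair_growthGrid hd hL ht hu h0 x.2).rule y y.2

theorem isGrowthImage_iff (hd : 0 < d) (hL : 0 < L) (ht : IsWalk n t) (hu : IsWalk m u)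
    (h0 : t 0 = u 0) {PQ : Filling d L × Filling d L} :
    IsGrowthImage m n (walkTableau t n) (walkTableau u m) PQ ↔
      PQ = (walkTableau (growthGrid t u m) n, walkTableau (fun x => growthGrid t u x n) m) := by
  have hright := ht.growthGrid hd hL hu h0 le_rfl
  have htop := isWalk_growthGrid_top hd hL ht hu h0
  constructor
  · rintro ⟨rho, hrho, h₁, h₂, h₃, h₄⟩
    rw [isGrowthDiagram_iff hd hL ht hu h0] at hrho
    subst hrho
    exact Prod.ext (hright.eq_walkTableau h₁ h₂) (htop.eq_walkTableau h₃ h₄)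
  · rintro rfl
    exact ⟨_, (isGrowthDiagram_iff hd hL ht hu h0).2 rfl, hright.walkTableau_mem_SCT hd hL,
      hright.isWalkRep_iff.2 fun _ => rfl, htop.walkTableau_mem_SCT hd hL,
      htop.isWalkRep_iff.2 fun _ => rfl⟩

theorem walkTableau_zero (w : ℕ → CylShape d L) :
    walkTableau w 0 = ⟨w 0, w 0, fun _ => 0⟩ := by
  ext1
  · rfl
  · rfl
  · ext c
    exact Nat.le_zero.1 (IsWalk.walkEntry_le_length (fun _ h => absurd h (Nat.not_lt_zero _)) c)

/-- Lengthening a walk does not change the step at which an earlier cell first appears. -/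
theorem IsWalk.placesAt {w : ℕ → CylShape d L} {k : ℕ} {i : ℤ} (hw : IsWalk (k + 1) w)
    (hi : (w k).AddsCell i (w (k + 1))) :
    PlacesAt (walkTableau w k) (cell i ((w k).row i + 1)) (k + 1) (walkTableau w (k + 1)) := by
  classical
  refine ⟨hi.notMem, hi.diagram_eq, rfl, ?_⟩
  ext c
  simp only [walkTableau, Filling.setEntry]
  by_cases hc : c = cell i ((w k).row i + 1)
  · subst hc
    rw [Function.update_self, hw.walkEntry_eq_succ (Nat.lt_succ_self k) hi.mem hi.notMem]
  · rw [Function.update_of_ne hc]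
    have hw' := hw.of_le (Nat.le_succ k)
    by_cases hk : c ∈ (w k).diagram
    · refine le_antisymm ?_ ?_
      · exact walkEntry_le ((walkEntry_le_self hk).trans (Nat.le_succ k)) (mem_walkEntry hk)
      · have h := walkEntry_le (n := k + 1) (Nat.le_succ k) hk
        exact walkEntry_le h (mem_walkEntry (hi.subset hk))
    · rw [hw'.walkEntry_of_notMem hk, hw.walkEntry_of_notMem fun h => hc (hi.eq_of_mem h hk)]

/-- Each insertion advances the growth grid by one column, and determinism forces every run of the
algorithm to follow these columns. -/
theorem isCRS_iff (hd : 0 < d) (hL : 0 < L) (ht : IsWalk n t) (hu : IsWalk m u)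
    (h0 : t 0 = u 0) {PQ : Filling d L × Filling d L} :
    IsCRS m (walkTableau t n) (walkTableau u m) PQ ↔
      PQ = (walkTableau (growthGrid t u m) n, walkTableau (fun x => growthGrid t u x n) m) := by
  have htop := isWalk_growthGrid_top hd hL ht hu h0
  have hstep : ∀ k < m, ∃ (i : ℤ) (c : Cell d L), (u k).AddsCell i (u (k + 1)) ∧
      IsInsertion i (walkTableau (growthGrid t u k) n)
        (walkTableau (growthGrid t u (k + 1)) n) c ∧
      PlacesAt (walkTableau (fun x => growthGrid t u x n) k) c (k + 1)
        (walkTableau (fun x => growthGrid t u x n) (k + 1)) := by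
    intro k hk
    obtain ⟨i, hi⟩ := hu k hk
    obtain ⟨r, hr⟩ := htop k hk
    refine ⟨i, _, hi, ?_, (htop.of_le hk).placesAt hr⟩
    refine (isColumnPair_growthGrid hd hL ht hu h0 hk).isInsertion hd hL ?_ hr.mem hr.notMem
    rwa [growthGrid_zero_right h0, growthGrid_zero_right h0]
  constructor
  · rintro ⟨P, Q, hP0, hQ0, hPQ, rfl⟩
    suffices h : ∀ (k : ℕ) (hk : k < m + 1), P ⟨k, hk⟩ = walkTableau (growthGrid t u k) n ∧
        Q ⟨k, hk⟩ = walkTableau (fun x => growthGrid t u x n) k by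
      obtain ⟨h₁, h₂⟩ := h m (Nat.lt_succ_self m)
      exact Prod.ext h₁ h₂
    intro k
    induction k with
    | zero =>
      refine fun _ => ⟨hP0, hQ0.trans ?_⟩
      rw [walkTableau_zero]
      rfl
    | succ k ih =>
      intro hk
      obtain ⟨hP, hQ⟩ := ih (by omega)
      obtain ⟨i, j, c, hij, hj, hins, hpl⟩ := hPQ ⟨k, by omega⟩
      obtain ⟨i', c', hi', hins', hpl'⟩ := hstep k (by omega)
      change IsInsertion i (P ⟨k, _⟩) (P ⟨k + 1, _⟩) c at hins
      change PlacesAt (Q ⟨k, _⟩) c (k + 1) (Q ⟨k + 1, _⟩) at hpl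
      rw [hP] at hins
      rw [hQ] at hpl
      -- The cell of `U` with entry `k + 1` is the one added at that step of `u`, so the insertion
      -- row is determined modulo `d`.
      obtain ⟨-, h₁, h₂⟩ := hu.of_walkEntry_eq_succ hij
      have hwalk := ht.growthGrid hd hL hu h0 (show k ≤ m by omega)
      obtain ⟨h₃, rfl⟩ := hins.unique hins' (modEq_of_cell_eq (hi'.eq_of_mem h₁ h₂))
        hwalk.distinct hwalk.entry_ne_zero
      exact ⟨h₃, hpl.unique hpl'⟩
  · rintro rfl
    refine ⟨fun k => walkTableau (growthGrid t u k) n,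
      fun k => walkTableau (fun x => growthGrid t u x n) k, rfl, walkTableau_zero _, ?_, rfl⟩
    intro k
    obtain ⟨i, c, hi, hins, hpl⟩ := hstep k k.2
    refine ⟨i, _, c, ?_, rfl, hins, hpl⟩
    change walkEntry u m (cell i ((growthGrid t u k 0).row i + 1)) = k + 1
    rw [growthGrid_zero_right h0]
    exact hu.walkEntry_eq_succ k.2 hi.mem hi.notMem

end Grid

theorem mainTheorem4 (d L : ℕ) (hd : 0 < d) (hL : 0 < L) (m n : ℕ)
    (mu alpha beta : CylShape d L)
    (hn : alpha.skewCard mu = n) (hm : beta.skewCard mu = m)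
    (T U : Filling d L) (hT : T ∈ SCT alpha mu) (hU : U ∈ SCT beta mu) :
    (∃! rho : Fin (m + 1) → Fin (n + 1) → CylShape d L, IsGrowthDiagram m n T U rho) ∧
    (∃! PQ : Filling d L × Filling d L, IsGrowthImage m n T U PQ) ∧
    (∃! PQ : Filling d L × Filling d L, IsCRS m T U PQ) ∧
    (∀ PQ : Filling d L × Filling d L, IsCRS m T U PQ →
      ∃ lam : CylShape d L, alpha ⊆ lam ∧ beta ⊆ lam ∧
        lam.skewCard beta = n ∧ lam.skewCard alpha = m ∧
        PQ.1 ∈ SCT lam beta ∧ PQ.2 ∈ SCT lam alpha) ∧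
    (∀ Pt Qt P Q : Filling d L,
      IsGrowthImage m n T U (Pt, Qt) → IsCRS m T U (P, Q) → (Pt, Qt) = (P, Q)) := by
  obtain ⟨t, ht, rfl, ht0, rfl⟩ := exists_walk_of_mem_SCT hT hn
  obtain ⟨u, hu, rfl, hu0, rfl⟩ := exists_walk_of_mem_SCT hU hm
  have h0 : t 0 = u 0 := ht0.trans hu0.symm
  have hright := ht.growthGrid hd hL hu h0 le_rfl
  have htop := isWalk_growthGrid_top hd hL ht hu h0
  have hbeta : growthGrid t u m 0 = u m := growthGrid_zero_right h0 m
  -- Each construction becomes an equality with an explicit object, the same pair for growth and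
  -- insertion.
  simp only [isGrowthDiagram_iff hd hL ht hu h0, isGrowthImage_iff hd hL ht hu h0,
    isCRS_iff hd hL ht hu h0]
  refine ⟨⟨_, rfl, fun _ h => h⟩, ⟨_, rfl, fun _ h => h⟩, ⟨_, rfl, fun _ h => h⟩, ?_,
    fun _ _ _ _ h h' => h.trans h'.symm⟩
  rintro _ rfl
  rw [← hbeta]
  exact ⟨growthGrid t u m n, htop.subset le_rfl (Nat.zero_le m),
    hright.subset le_rfl (Nat.zero_le n), hright.skewCard, htop.skewCard,
    hright.walkTableau_mem_SCT hd hL, htop.walkTableau_mem_SCT hd hL⟩
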